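/- A *standard space* is a locally compact separable metric space. Let $q: Y\to X$ be a quotient map from a standard space $Y$ onto a Hausdorff space $X$. Let ${\rm Cl}(Y)$ be the set of closed subsets of $Y$ with the Fell topology (generated by the sets $\{F: F\cap K=\emptyset\}$, $K\subseteq Y$ compact, and $\{F: F\cap U\ne\emptyset\}$, $U\subseteq Y$ open). Let $Y_*$ be the space of all non-empty members of the closure in ${\rm Cl}(Y)$ of the set of fibres $\{q^{-1}(x): x\in X\}$, and define $q_*: Y_*\to X$ by $q_*(F)=q(y)$ for $y\in F$ (this does not depend on $y\in F$). Let $V$ be the closure in $Y_*$ of the set of singleton fibres of $q_*$, that is, of $\{F\in Y_*: q_*^{-1}(q_*(F))=\{F\}\}$. A point $x\in X$ is *of compact type* if there is a compact set $K\subseteq X$ such that every sequence in $X$ converging to $x$ is eventually in $K$. A subset $E\subseteq X$ is *sequentially dense* if every point of $X$ is the limit of a sequence in $E$. A surjective map is *irreducible* if it maps no proper closed subset of its domain onto its codomain. For $E\subseteq X$ consider the following properties. (a) Whenever $(x_m)$ is a sequence of distinct points in $E$ with limit $x_0\in X$, there is a subsequence $(x_n)$ such that for all sequences $(x_n^j)_j$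 in $X$ with $x_n^j\to x_n$ as $j\to\infty$ $(n\ge 1)$ there exist natural numbers $k_n$ $(n\ge 1)$ such that the set $\{x_n^j: n\ge 1,\ j\ge k_n\}$ has compact closure in $X$. (b) Whenever $(x_m)$ is a sequence of distinct points in $X$ with limit $x_0\in X$, there are a subsequence $(x_n)$ and sequences $(x_n^j)_j$ in $E$ with $x_n^j\to x_n$ as $j\to\infty$ $(n\ge 1)$ such that every diagonal sequence $(x_n^{j_n})_n$, where $(j_n)$ is any sequence of natural numbers, converges to $x_0$. **Theorem.** The following are equivalent: (i) $X$ has a sequentially dense subset $E$ such that each $x\in E$ is of compact type and $X$ and $E$ have properties (a) and (b); (ii) the restriction $q_*|V: V\to X$ is an irreducible quotient map from $V$ onto $X$. -/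

import Mathlib

namespace FellQuotient

open Set Filter Topology TopologicalSpace

universe u v

/-- `Cl(Y)`: the closed subsets of `Y` (the empty set included). A separate type is used, since
Mathlib's `Closeds Y` already carries another topology when `Y` is a metric space. -/
@[ext]
structure Cl (Y : Type u) [TopologicalSpace Y] where
  /-- the underlying set -/
  carrier : Set Y
  isClosed : IsClosed carrier

/-- The Fell topology on `Cl(Y)`: the subbasic open sets are `{F | F ∩ K = ∅}` for `K ⊆ Y` compact
and `{F | F ∩ U ≠ ∅}` for `U ⊆ Y` open. -/
instance fellTopology (Y : Type u) [TopologicalSpace Y] : TopologicalSpace (Cl Y) :=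
  generateFrom
    ({s | ∃ K : Set Y, IsCompact K ∧ s = {F : Cl Y | F.carrier ∩ K = ∅}} ∪
      {s | ∃ U : Set Y, IsOpen U ∧ s = {F : Cl Y | (F.carrier ∩ U).Nonempty}})

variable {X : Type u} {Y : Type v} [TopologicalSpace X] [TopologicalSpace Y]

/-- The set of fibres `q⁻¹(x)`, `x ∈ X`, as a subset of `Cl(Y)`. (For continuous `q` and Hausdorff
`X` every fibre is closed.) -/
def fibres (q : Y → X) : Set (Cl Y) := {F | ∃ x : X, F.carrier = q ⁻¹' {x}}

/-- `Y_*`: the non-empty members of the closure of the set of fibres in the Fell topology, with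
the subspace topology. -/
def YStar (q : Y → X) : Type v := {F : Cl Y // F ∈ closure (fibres q) ∧ F.carrier.Nonempty}

instance (q : Y → X) : TopologicalSpace (YStar q) :=
  inferInstanceAs (TopologicalSpace {F : Cl Y // F ∈ closure (fibres q) ∧ F.carrier.Nonempty})

/-- `q_* : Y_* → X`, `q_*(F) = q(y)` for `y ∈ F`; the choice of `y` is immaterial by
`qStar_eq`. -/
noncomputable def qStar (q : Y → X) (F : YStar q) : X := q F.property.2.some

/-- `q_*` is well defined. -/
theorem qStar_eq [T2Space X] {q : Y → X} (hq : Continuous q) (F : YStar q) {y : Y}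
    (hy : y ∈ F.val.carrier) : qStar q F = q y := by
  by_contra hne
  obtain ⟨A, B, hA, hB, hxA, hyB, hAB⟩ := t2_separation hne
  have h1 : IsOpen {G : Cl Y | (G.carrier ∩ q ⁻¹' A).Nonempty} :=
    isOpen_generateFrom_of_mem (Or.inr ⟨_, hA.preimage hq, rfl⟩)
  have h2 : IsOpen {G : Cl Y | (G.carrier ∩ q ⁻¹' B).Nonempty} :=
    isOpen_generateFrom_of_mem (Or.inr ⟨_, hB.preimage hq, rfl⟩)
  obtain ⟨G, ⟨⟨a, haG, haA⟩, ⟨b, hbG, hbB⟩⟩, x, hx⟩ :=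
    mem_closure_iff.1 F.property.1 _ (h1.inter h2)
      ⟨⟨_, F.property.2.some_mem, hxA⟩, ⟨y, hy, hyB⟩⟩
  rw [hx] at haG hbG
  have ha : q a = x := haG
  have hb : q b = x := hbG
  have haA' : q a ∈ A := haA
  have hbB' : q b ∈ B := hbB
  rw [ha] at haA'
  rw [hb] at hbB'
  exact Set.disjoint_left.1 hAB haA' hbB'

/-- The points of the domain that form a singleton fibre of `f`. -/
def singletonFibres {A : Type*} {B : Type*} (f : A → B) : Set A := {a | f ⁻¹' {f a} = {a}}

/-- `V`: the closure in `Y_*` of the set of singleton fibres of `q_* : Y_* → X`. -/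
def VStar (q : Y → X) : Set (YStar q) := closure (singletonFibres (qStar q))

/-- A surjective map is irreducible if no proper closed subset of its domain is mapped onto the
codomain. -/
def IsIrreducibleMap {A : Type*} {B : Type*} [TopologicalSpace A] (f : A → B) : Prop :=
  Function.Surjective f ∧ ∀ C : Set A, IsClosed C → f '' C = univ → C = univ

/-- `x` is a point of compact type: some compact set eventually contains every sequence that
converges to `x`. -/
def IsCompactType (x : X) : Prop :=
  ∃ K : Set X, IsCompact K ∧
    ∀ u : ℕ → X, Tendsto u atTop (𝓝 x) → ∀ᶠ n in atTop, u n ∈ K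

/-- Every point of `X` is the limit of a sequence in `E`. -/
def SeqDense (E : Set X) : Prop := seqClosure E = univ

/-- Property (a) of `X` and `E`. -/
def PropertyA (E : Set X) : Prop :=
  ∀ (x : ℕ → X) (x₀ : X), Function.Injective x → (∀ m, x m ∈ E) → Tendsto x atTop (𝓝 x₀) →
    ∃ φ : ℕ → ℕ, StrictMono φ ∧
      ∀ z : ℕ → ℕ → X, (∀ n, Tendsto (z n) atTop (𝓝 (x (φ n)))) →
        ∃ k : ℕ → ℕ, IsCompact (closure {y : X | ∃ n j : ℕ, k n ≤ j ∧ y = z n j})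

/-- Property (b) of `X` and `E`. A diagonal sequence picks one term from each of the sequences
`z 0`, `z 1`, … -/
def PropertyB (E : Set X) : Prop :=
  ∀ (x : ℕ → X) (x₀ : X), Function.Injective x → Tendsto x atTop (𝓝 x₀) →
    ∃ φ : ℕ → ℕ, StrictMono φ ∧
      ∃ z : ℕ → ℕ → X, (∀ n j, z n j ∈ E) ∧
        (∀ n, Tendsto (z n) atTop (𝓝 (x (φ n)))) ∧
        ∀ d : ℕ → ℕ, Tendsto (fun n => z n (d n)) atTop (𝓝 x₀)

end FellQuotient

/-! Fix a compact exhaustion `K n` of `Y` and put X_n = `q '' K n`. As `q` is a quotient map, every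
compact set and every convergent sequence of `X` lies in one X_n. This makes (i) a statement about
these sets: compact type with (a) gives E ∩ X_n ⊆ `stablePoints q K m` for some m, and sequential
density with (b) gives X_n ⊆ closure (E ∩ X_m) for some m; both inclusions also imply the properties
back.

From (ii) to (i), take E = `rigidPoints q`, the points under singleton fibres of `q_*`. Compactness
of the Fell topology makes rigid points stable (`rigidPoints_inter_image_subset`), and the quotient
map on `V` makes them dense in the required sense.

From (i) to (ii), stable points are dense in each X_n, within a fixed stability level. A Baire
argument in the compact space X_p (`stablePoints_subset_closure`) turns stable points into limits of
rigid ones. So each X_n is covered by the image of a compact subset of `V`, which gives the quotient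
map; irreducibility follows from surjectivity. -/

namespace FellQuotient

open Set Filter Topology TopologicalSpace

universe u v

/-! ### Quotient maps and exhaustions -/

section Coherent

variable {X : Type u} {Y : Type v} [TopologicalSpace X] [TopologicalSpace Y]

/-- If `f` is a quotient map and the `W n` exhaust its domain, with each in the interior of the
next, then a compact subset of the codomain is covered by one of the images `f '' W n`. -/
theorem exists_subset_image_of_isCompact [T2Space X] {f : Y → X} (hf : IsQuotientMap f)
    {W : ℕ → Set Y} (hW : ∀ n, W n ⊆ interior (W (n + 1))) (hU : ∀ y, ∃ n, y ∈ W n)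
    {C : Set X} (hC : IsCompact C) : ∃ n, C ⊆ f '' W n := by
  have hmono : Monotone W := monotone_nat_of_le_succ fun n => (hW n).trans interior_subset
  by_contra! h
  have h' : ∀ n, ∃ x ∈ C, x ∉ f '' W n := fun n => not_subset.1 (h n)
  choose c hcC hc using h'
  obtain ⟨x, -, hx⟩ := hC.exists_mapClusterPt (f := atTop) (u := c) (by simp [hcC])
  obtain ⟨y, rfl⟩ := hf.surjective x
  obtain ⟨m, hm⟩ := hU y
  -- Each point of `Y` has a neighbourhood `W (k + 1)` whose image contains only `c n` with n ≤ k,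
  -- so tails of `c` are closed and cannot accumulate at `f y`.
  have hclosed : IsClosed (c '' Ici m) := by
    rw [← hf.isClosed_preimage, ← isOpen_compl_iff, isOpen_iff_mem_nhds]
    intro z hz
    obtain ⟨k, hk⟩ := hU z
    have hfin : IsClosed (f ⁻¹' (c '' (Ici m ∩ Iio (k + 1)))) :=
      (((finite_Iio (k + 1)).subset inter_subset_right).image c).isClosed.preimage hf.continuous
    have hz' : z ∈ (f ⁻¹' (c '' (Ici m ∩ Iio (k + 1))))ᶜ := fun h =>
      hz (image_mono inter_subset_left h)
    filter_upwards [isOpen_interior.mem_nhds (hW k hk), hfin.isOpen_compl.mem_nhds hz']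
      with w hw hw' ⟨n, hn, hnw⟩
    refine hw' ⟨n, ⟨hn, ?_⟩, hnw⟩
    by_contra hnk
    exact hc n ⟨w, hmono (not_lt.1 hnk) (interior_subset hw), hnw.symm⟩
  have hy : f y ∈ (c '' Ici m)ᶜ := by
    rintro ⟨n, hn, hnw⟩
    exact hc n ⟨y, hmono hn hm, hnw.symm⟩
  obtain ⟨n, hn, hn'⟩ :=
    ((hx.frequently (hclosed.isOpen_compl.mem_nhds hy)).and_eventually
      (eventually_ge_atTop m)).exists
  exact hn ⟨n, hn', rfl⟩

/-- A convergent sequence of the codomain of a quotient map lies in the image of one member of an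
exhaustion of the domain. -/
theorem exists_forall_mem_image_of_tendsto [T2Space X] {f : Y → X} (hf : IsQuotientMap f)
    {W : ℕ → Set Y} (hW : ∀ n, W n ⊆ interior (W (n + 1))) (hU : ∀ y, ∃ n, y ∈ W n)
    {c : ℕ → X} {x : X} (hc : Tendsto c atTop (𝓝 x)) : ∃ n, ∀ k, c k ∈ f '' W n := by
  obtain ⟨n, hn⟩ := exists_subset_image_of_isCompact hf hW hU hc.isCompact_insert_range
  exact ⟨n, fun k => hn (mem_insert_of_mem _ (mem_range_self k))⟩

/-- A continuous surjection onto a Hausdorff space is a quotient map as soon as its images of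
compact sets cover the images of an exhaustion under some quotient map. -/
theorem isQuotientMap_of_image_subset {Z : Type*} [TopologicalSpace Z] [T2Space X] {q : Y → X}
    (hq : IsQuotientMap q) (K : CompactExhaustion Y) {r : Z → X} (hr : Continuous r)
    (h : ∀ n, ∃ C : Set Z, IsCompact C ∧ q '' K n ⊆ r '' C) : IsQuotientMap r := by
  have hsurj : Function.Surjective r := by
    intro x
    obtain ⟨y, rfl⟩ := hq.surjective x
    obtain ⟨n, hn⟩ := K.exists_mem y
    obtain ⟨C, -, hC⟩ := h n
    obtain ⟨z, -, hz⟩ := hC ⟨y, hn, rfl⟩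
    exact ⟨z, hz⟩
  refine isQuotientMap_iff_isClosed.2 ⟨hsurj, fun A => ⟨fun hA => hA.preimage hr, fun hA => ?_⟩⟩
  rw [← hq.isClosed_preimage, ← isOpen_compl_iff, isOpen_iff_mem_nhds]
  intro y hy
  obtain ⟨n, hn⟩ := K.exists_mem_nhds y
  obtain ⟨C, hC, hCn⟩ := h n
  -- Over `q '' K n` the set `A` coincides with this compact image.
  have hcl : IsClosed (r '' (C ∩ r ⁻¹' A)) := ((hC.inter_right hA).image hr).isClosed
  have hy' : y ∈ (q ⁻¹' (r '' (C ∩ r ⁻¹' A)))ᶜ := by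
    rintro ⟨z, ⟨-, hz⟩, hzy⟩
    exact hy (show q y ∈ A from hzy ▸ hz)
  filter_upwards [hn, (hcl.preimage hq.continuous).isOpen_compl.mem_nhds hy'] with w hw hw' hwA
  obtain ⟨z, hz, hzw⟩ := hCn ⟨w, hw, rfl⟩
  exact hw' ⟨z, ⟨hz, show r z ∈ A from hzw ▸ hwA⟩, hzw⟩

/-- A sequence that leaves every member of an exhaustive increasing sequence of sets has an
injective subsequence. -/
theorem exists_strictMono_injective {α : Type*} {D : ℕ → Set α} (hD : Monotone D)
    {c : ℕ → α} (hc : ∀ n, c n ∉ D n) (hU : ∀ n, ∃ m, c n ∈ D m) :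
    ∃ φ : ℕ → ℕ, StrictMono φ ∧ Function.Injective (c ∘ φ) := by
  classical
  -- `ρ n` is the first index of a set containing `c n`; it depends only on the point `c n`, and n ≤
  -- `ρ n`.
  choose ρ hρ using fun n => (⟨Nat.find (hU n), Nat.find_spec (hU n), fun m hm =>
    Nat.find_min' (hU n) hm⟩ : ∃ k, c n ∈ D k ∧ ∀ m, c n ∈ D m → k ≤ m)
  have hle : ∀ n, n ≤ ρ n := fun n => by
    by_contra hlt
    exact hc n (hD (not_le.1 hlt).le (hρ n).1)
  obtain ⟨φ, hφ, hφ'⟩ := strictMono_subseq_of_id_le hle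
  refine ⟨φ, hφ, fun a b hab => hφ'.injective ?_⟩
  have hab' : c (φ a) = c (φ b) := hab
  exact le_antisymm ((hρ _).2 _ (hab' ▸ (hρ (φ b)).1)) ((hρ _).2 _ (hab' ▸ (hρ (φ a)).1))

end Coherent

/-! ### Sequences lifted to compact metric sets -/

section Lifting

theorem exists_tendsto_subseq_of_mem_image {X : Type u} {Y : Type v} [TopologicalSpace X]
    [MetricSpace Y] {q : Y → X} (hq : Continuous q) {C : Set Y} (hC : IsCompact C)
    {c : ℕ → X} (hc : ∀ n, c n ∈ q '' C) :
    ∃ x, ∃ φ : ℕ → ℕ, StrictMono φ ∧ Tendsto (c ∘ φ) atTop (𝓝 x) := by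
  choose y hy hyc using hc
  obtain ⟨w, -, φ, hφ, hlim⟩ := hC.tendsto_subseq hy
  obtain rfl : q ∘ y = c := funext hyc
  exact ⟨q w, φ, hφ, (hq.tendsto w).comp hlim⟩

/-- If a sequence in `q '' C`, `C` compact metrizable, leaves every member of an exhaustive
increasing sequence of sets, then it has a convergent injective subsequence. -/
theorem exists_injective_tendsto_subseq {X : Type u} {Y : Type v} [TopologicalSpace X]
    [MetricSpace Y] {q : Y → X} (hq : Continuous q) {C : Set Y} (hC : IsCompact C)
    {D : ℕ → Set X} (hD : Monotone D) {c : ℕ → X} (hcC : ∀ n, c n ∈ q '' C)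
    (hc : ∀ n, c n ∉ D n) (hU : ∀ n, ∃ m, c n ∈ D m) :
    ∃ x, ∃ φ : ℕ → ℕ, StrictMono φ ∧ Function.Injective (c ∘ φ) ∧
      Tendsto (c ∘ φ) atTop (𝓝 x) := by
  obtain ⟨φ, hφ, hinj⟩ := exists_strictMono_injective hD hc hU
  obtain ⟨x, ψ, hψ, hlim⟩ := exists_tendsto_subseq_of_mem_image hq hC (c := c ∘ φ)
    fun n => hcC (φ n)
  exact ⟨x, φ ∘ ψ, hφ.comp hψ, hinj.comp hψ.injective, hlim⟩

variable {X : Type u} {Y : Type v} [TopologicalSpace X] [T2Space X] [MetricSpace Y]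

/-- Points in the closure of a subset of `q '' K`, `K` compact metrizable, are limits of sequences
that can be lifted to `K`. -/
theorem exists_lift_of_mem_closure {q : Y → X} (hq : Continuous q) {K : Set Y} (hK : IsCompact K)
    {A : Set X} (hA : A ⊆ q '' K) {x : X} (hx : x ∈ closure A) :
    ∃ w ∈ K, q w = x ∧ ∃ u : ℕ → Y, (∀ j, q (u j) ∈ A) ∧ Tendsto u atTop (𝓝 w) := by
  have hcpt : IsCompact (closure (K ∩ q ⁻¹' A)) :=
    hK.of_isClosed_subset isClosed_closure (closure_minimal inter_subset_left hK.isClosed)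
  have hsub : closure A ⊆ q '' closure (K ∩ q ⁻¹' A) := by
    refine closure_minimal (fun a ha => ?_) (hcpt.image hq).isClosed
    obtain ⟨y, hy, rfl⟩ := hA ha
    exact ⟨y, subset_closure ⟨hy, ha⟩, rfl⟩
  obtain ⟨w, hw, rfl⟩ := hsub hx
  obtain ⟨u, hu, hlim⟩ := mem_closure_iff_seq_limit.1 hw
  exact ⟨w, closure_minimal inter_subset_left hK.isClosed hw, rfl, u, fun j => (hu j).2, hlim⟩

theorem exists_seq_of_mem_closure {q : Y → X} (hq : Continuous q) {K : Set Y} (hK : IsCompact K)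
    {A : Set X} (hA : A ⊆ q '' K) {x : X} (hx : x ∈ closure A) :
    ∃ u : ℕ → X, (∀ j, u j ∈ A) ∧ Tendsto u atTop (𝓝 x) := by
  obtain ⟨w, -, rfl, u, hu, hlim⟩ := exists_lift_of_mem_closure hq hK hA hx
  exact ⟨q ∘ u, hu, (hq.tendsto w).comp hlim⟩

end Lifting

/-! ### Stable points -/

section Stable

variable {X : Type u} {Y : Type v} [TopologicalSpace X] [TopologicalSpace Y]

/-- The points of `X` that have `q '' K n` as a neighbourhood relative to each `q '' K m`. -/
def stablePoints (q : Y → X) (K : CompactExhaustion Y) (n : ℕ) : Set X :=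
  {x | ∀ m, x ∉ closure (q '' K m \ q '' K n)}

variable {q : Y → X} {K : CompactExhaustion Y}

theorem stablePoints_mono : Monotone (stablePoints q K) := fun _ _ hab _ hx m h =>
  hx m (closure_mono (sdiff_subset_sdiff_right (image_mono (K.subset hab))) h)

theorem exists_mem_image (hq : IsQuotientMap q) (K : CompactExhaustion Y) (x : X) :
    ∃ n, x ∈ q '' K n := by
  obtain ⟨y, rfl⟩ := hq.surjective x
  obtain ⟨n, hn⟩ := K.exists_mem y
  exact ⟨n, y, hn, rfl⟩

theorem stablePoints_subset_image (hq : IsQuotientMap q) (n : ℕ) :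
    stablePoints q K n ⊆ q '' K n := by
  intro x hx
  obtain ⟨m, hm⟩ := exists_mem_image hq K x
  by_contra hn
  exact hx m (subset_closure ⟨hm, hn⟩)

theorem exists_forall_mem_of_tendsto [T2Space X] (hq : IsQuotientMap q) (K : CompactExhaustion Y)
    {c : ℕ → X} {x : X} (hc : Tendsto c atTop (𝓝 x)) : ∃ n, ∀ k, c k ∈ q '' K n :=
  exists_forall_mem_image_of_tendsto hq K.subset_interior_succ K.exists_mem hc

theorem eventually_mem_of_mem_stablePoints [T2Space X] (hq : IsQuotientMap q) {n : ℕ} {x : X}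
    (hx : x ∈ stablePoints q K n) {c : ℕ → X} (hc : Tendsto c atTop (𝓝 x)) :
    ∀ᶠ k in atTop, c k ∈ q '' K n := by
  obtain ⟨m, hm⟩ := exists_forall_mem_of_tendsto hq K hc
  filter_upwards [hc (isClosed_closure.isOpen_compl.mem_nhds (hx m))] with k hk
  by_contra hn
  exact hk (subset_closure ⟨hm k, hn⟩)

end Stable

/-! ### Compact type, (a) and (b) in terms of the exhaustion -/

section Sequences

variable {X : Type u} {Y : Type v} [TopologicalSpace X] [T2Space X] [MetricSpace Y] {q : Y → X}
  {E : Set X}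

theorem IsCompactType.exists_mem_stablePoints (hq : IsQuotientMap q) (K : CompactExhaustion Y)
    {x : X} (hx : IsCompactType x) : ∃ n, x ∈ stablePoints q K n := by
  obtain ⟨C, hC, hCx⟩ := hx
  obtain ⟨n, hn⟩ := exists_subset_image_of_isCompact hq K.subset_interior_succ K.exists_mem hC
  refine ⟨n, fun m hm => ?_⟩
  obtain ⟨u, hu, hlim⟩ := exists_seq_of_mem_closure hq.continuous (K.isCompact m) sdiff_subset hm
  obtain ⟨j, hj⟩ := (hCx u hlim).exists
  exact (hu j).2 (hn hj)

/-- Otherwise some convergent sequence in `E` has its m-th term approached from outside X_m; tails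
of these approaching sequences escape every X_l, so their union has no compact closure. -/
theorem PropertyA.exists_subset_stablePoints (hA : PropertyA E) (hq : IsQuotientMap q)
    (K : CompactExhaustion Y) (hE : ∀ x ∈ E, IsCompactType x) (n : ℕ) :
    ∃ m, E ∩ q '' K n ⊆ stablePoints q K m := by
  by_contra! h
  have h' : ∀ m, ∃ x ∈ E ∩ q '' K n, x ∉ stablePoints q K m := fun m => not_subset.1 (h m)
  choose c hcE hc using h'
  obtain ⟨x, φ, hφ, hinj, hlim⟩ := exists_injective_tendsto_subseq hq.continuous (K.isCompact n)
    stablePoints_mono (fun m => (hcE m).2) hc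
    fun m => (hE _ (hcE m).1).exists_mem_stablePoints hq K
  obtain ⟨ψ, hψ, hz⟩ := hA _ x hinj (fun m => (hcE _).1) hlim
  have hz' : ∀ k, ∃ u : ℕ → X, (∀ j, u j ∉ q '' K (φ (ψ k))) ∧
      Tendsto u atTop (𝓝 (c (φ (ψ k)))) := by
    intro k
    obtain ⟨m, hm⟩ := not_forall_not.1 (hc (φ (ψ k)))
    obtain ⟨u, hu, hu'⟩ := exists_seq_of_mem_closure hq.continuous (K.isCompact m) sdiff_subset hm
    exact ⟨u, fun j => (hu j).2, hu'⟩
  choose z hzK hzlim using hz'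
  obtain ⟨k, hk⟩ := hz z hzlim
  obtain ⟨l, hl⟩ := exists_subset_image_of_isCompact hq K.subset_interior_succ K.exists_mem hk
  refine hzK l (k l) (image_mono (K.subset ((hφ.comp hψ).id_le l)) ?_)
  exact hl (subset_closure ⟨l, k l, le_rfl, rfl⟩)

/-- Otherwise a diagonal sequence can be chosen that leaves every X_l, and so does not converge. -/
theorem PropertyB.exists_subset_closure (hB : PropertyB E) (hq : IsQuotientMap q)
    (K : CompactExhaustion Y) (hE : SeqDense E) (n : ℕ) :
    ∃ m, q '' K n ⊆ closure (E ∩ q '' K m) := by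
  by_contra! h
  have h' : ∀ m, ∃ x ∈ q '' K n, x ∉ closure (E ∩ q '' K m) := fun m => not_subset.1 (h m)
  choose c hcn hc using h'
  have hmono : Monotone fun m => closure (E ∩ q '' K m) := fun a b hab =>
    closure_mono (inter_subset_inter_right _ (image_mono (K.subset hab)))
  have hU : ∀ k, ∃ m, c k ∈ closure (E ∩ q '' K m) := by
    intro k
    obtain ⟨u, hu, hlim⟩ : c k ∈ seqClosure E := hE ▸ mem_univ _
    obtain ⟨m, hm⟩ := exists_forall_mem_of_tendsto hq K hlim
    exact ⟨m, mem_closure_of_tendsto hlim (Eventually.of_forall fun j => ⟨hu j, hm j⟩)⟩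
  obtain ⟨x, φ, hφ, hinj, hlim⟩ := exists_injective_tendsto_subseq hq.continuous (K.isCompact n)
    hmono hcn hc hU
  obtain ⟨ψ, hψ, z, hzE, hzlim, hz⟩ := hB _ x hinj hlim
  have hd : ∀ k, ∃ j, z k j ∉ q '' K (φ (ψ k)) := by
    intro k
    by_contra! hall
    exact hc _ (mem_closure_of_tendsto (hzlim k) (Eventually.of_forall fun j => ⟨hzE k j, hall j⟩))
  choose d hd using hd
  obtain ⟨l, hl⟩ := exists_forall_mem_of_tendsto hq K (hz d)
  exact hd l (image_mono (K.subset ((hφ.comp hψ).id_le l)) (hl l))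

end Sequences

/-! ### Compactness of the Fell topology -/

section Fell

variable {Y : Type v} [TopologicalSpace Y]

theorem isOpen_setOf_inter_nonempty {U : Set Y} (hU : IsOpen U) :
    IsOpen {F : Cl Y | (F.carrier ∩ U).Nonempty} :=
  isOpen_generateFrom_of_mem (Or.inr ⟨U, hU, rfl⟩)

theorem isOpen_setOf_inter_eq_empty {C : Set Y} (hC : IsCompact C) :
    IsOpen {F : Cl Y | F.carrier ∩ C = ∅} :=
  isOpen_generateFrom_of_mem (Or.inl ⟨C, hC, rfl⟩)

theorem isClosed_setOf_inter_nonempty {C : Set Y} (hC : IsCompact C) :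
    IsClosed {F : Cl Y | (F.carrier ∩ C).Nonempty} := by
  rw [← isOpen_compl_iff]
  convert isOpen_setOf_inter_eq_empty hC using 1
  ext F
  simp [not_nonempty_iff_eq_empty]

/-- The Fell topology is compact. -/
instance compactSpace_cl : CompactSpace (Cl Y) := by
  refine ⟨isCompact_iff_ultrafilter_le_nhds.2 fun 𝒰 _ => ?_⟩
  -- The limit of `𝒰`: the points each of whose neighbourhoods meets `𝒰`-almost every set.
  let L : Set Y := {y | ∀ U : Set Y, IsOpen U → y ∈ U →
    {G : Cl Y | (G.carrier ∩ U).Nonempty} ∈ 𝒰}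
  have hL : IsClosed L := by
    rw [← isOpen_compl_iff, isOpen_iff_mem_nhds]
    intro y hy
    obtain ⟨U, hU, hyU, h⟩ : ∃ U : Set Y, IsOpen U ∧ y ∈ U ∧
        {G : Cl Y | (G.carrier ∩ U).Nonempty} ∉ 𝒰 := by simpa [L] using hy
    filter_upwards [hU.mem_nhds hyU] with w hw hwL
    exact h (hwL U hU hw)
  refine ⟨⟨L, hL⟩, mem_univ _, ?_⟩
  rw [nhds_generateFrom]
  refine le_iInf₂ fun s hs => le_principal_iff.2 ?_
  obtain ⟨hLs, ⟨C, hC, rfl⟩ | ⟨U, hU, rfl⟩⟩ := hs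
  · have hmem : ∀ y ∈ C, ∃ U : Set Y, IsOpen U ∧ y ∈ U ∧
        {G : Cl Y | (G.carrier ∩ U).Nonempty} ∉ 𝒰 := by
      intro y hy
      have hyL : y ∉ L := fun h => (eq_empty_iff_forall_notMem.1 hLs) y ⟨h, hy⟩
      simpa [L] using hyL
    choose! U hU hyU hUU using hmem
    obtain ⟨t, htC, ht⟩ := hC.elim_nhds_subcover U fun y hy => (hU y hy).mem_nhds (hyU y hy)
    have hall : ∀ᶠ G : Cl Y in (𝒰 : Filter (Cl Y)), ∀ y ∈ t, ¬(G.carrier ∩ U y).Nonempty := by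
      rw [Filter.eventually_all_finset]
      exact fun y hy => Ultrafilter.eventually_not.2 (hUU y (htC y hy))
    filter_upwards [hall] with G hG
    refine eq_empty_iff_forall_notMem.2 fun w hw => ?_
    obtain ⟨y, hy, hwy⟩ := mem_iUnion₂.1 (ht hw.2)
    exact hG y hy ⟨w, hw.1, hwy⟩
  · obtain ⟨y, hy, hyU⟩ := hLs
    exact hy U hU hyU

end Fell

/-! ### The space `Y_*` and rigid points -/

section YStar

variable {X : Type u} {Y : Type v} [TopologicalSpace Y] {q : Y → X}

theorem continuous_val : Continuous fun F : YStar q => F.val := continuous_subtype_val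

/-- The members of `Y_*` that meet `A`. -/
def meeting (q : Y → X) (A : Set Y) : Set (YStar q) := {F | (F.val.carrier ∩ A).Nonempty}

theorem meeting_mono {A B : Set Y} (h : A ⊆ B) : meeting q A ⊆ meeting q B := fun _ hF =>
  hF.mono (inter_subset_inter_right _ h)

theorem isOpen_meeting {U : Set Y} (hU : IsOpen U) : IsOpen (meeting q U) :=
  (isOpen_setOf_inter_nonempty hU).preimage continuous_val

/-- Meeting a compact set is a closed condition in the compact space `Cl Y`, and it already excludes
the empty set. -/
theorem isCompact_meeting {C : Set Y} (hC : IsCompact C) : IsCompact (meeting q C) := by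
  have hcl : IsClosed (closure (fibres q) ∩ {F : Cl Y | (F.carrier ∩ C).Nonempty}) :=
    isClosed_closure.inter (isClosed_setOf_inter_nonempty hC)
  have hind : IsInducing fun F : YStar q => F.val := ⟨rfl⟩
  rw [hind.isCompact_iff]
  convert hcl.isCompact using 1
  ext F
  constructor
  · rintro ⟨G, hG, rfl⟩
    exact ⟨G.property.1, hG⟩
  · rintro ⟨hF, hFC⟩
    exact ⟨⟨F, hF, hFC.mono inter_subset_left⟩, hFC, rfl⟩

theorem qStar_eq_of_mem [TopologicalSpace X] [T2Space X] (hq : Continuous q) {F : YStar q} {y : Y}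
    (hy : y ∈ F.val.carrier) : q y = qStar q F := (qStar_eq hq F hy).symm

theorem carrier_subset [TopologicalSpace X] [T2Space X] (hq : Continuous q) (F : YStar q) :
    F.val.carrier ⊆ q ⁻¹' {qStar q F} := fun _ hy => qStar_eq_of_mem hq hy

theorem preimage_qStar [TopologicalSpace X] [T2Space X] (hq : Continuous q) (A : Set X) :
    qStar q ⁻¹' A = meeting q (q ⁻¹' A) := by
  ext F
  constructor
  · intro hF
    obtain ⟨y, hy⟩ := F.property.2
    refine ⟨y, hy, ?_⟩
    rw [mem_preimage, qStar_eq_of_mem hq hy]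
    exact hF
  · rintro ⟨y, hy, hyA⟩
    rw [mem_preimage, qStar_eq hq F hy]
    exact hyA

theorem continuous_qStar [TopologicalSpace X] [T2Space X] (hq : Continuous q) :
    Continuous (qStar q) :=
  continuous_def.2 fun U hU => by
    rw [preimage_qStar hq]
    exact isOpen_meeting (hU.preimage hq)

theorem exists_fibre [TopologicalSpace X] [T2Space X] (hq : IsQuotientMap q) (x : X) :
    ∃ F : YStar q, F.val.carrier = q ⁻¹' {x} ∧ qStar q F = x := by
  obtain ⟨y, hy⟩ := hq.surjective x
  let F : YStar q := ⟨⟨q ⁻¹' {x}, isClosed_singleton.preimage hq.continuous⟩,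
    subset_closure ⟨x, rfl⟩, y, hy⟩
  exact ⟨F, rfl, (qStar_eq hq.continuous F hy).trans hy⟩

/-- Members of `Y_*` are approximated by fibres. -/
theorem exists_fibre_inter (F : YStar q) {U C : Set Y} (hU : IsOpen U) (hC : IsCompact C)
    (hFU : (F.val.carrier ∩ U).Nonempty) (hFC : F.val.carrier ∩ C = ∅) :
    ∃ y ∈ U, ∀ z ∈ C, q z ≠ q y := by
  obtain ⟨G, ⟨⟨y, hyG, hyU⟩, hGC⟩, x, hx⟩ := mem_closure_iff.1 F.property.1 _
    ((isOpen_setOf_inter_nonempty hU).inter (isOpen_setOf_inter_eq_empty hC)) ⟨hFU, hFC⟩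
  refine ⟨y, hyU, fun z hz hzy => eq_empty_iff_forall_notMem.1 hGC z ⟨?_, hz⟩⟩
  rw [hx] at hyG ⊢
  exact hzy.trans hyG

/-- The points of `X` over which `q_*` has only one point, namely the fibre of `q`. -/
def rigidPoints (q : Y → X) : Set X :=
  {x | ∀ F : YStar q, qStar q F = x → F.val.carrier = q ⁻¹' {x}}

theorem mem_singletonFibres_iff [TopologicalSpace X] [T2Space X] (hq : IsQuotientMap q)
    {F : YStar q} :
    F ∈ singletonFibres (qStar q) ↔ qStar q F ∈ rigidPoints q := by
  constructor
  · intro hF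
    have key : ∀ G, qStar q G = qStar q F → G = F := fun G hG =>
      (show qStar q ⁻¹' {qStar q F} = {F} from hF).subset hG
    obtain ⟨H, hH, hH'⟩ := exists_fibre hq (qStar q F)
    intro G hG
    rw [key G hG, ← key H hH', hH]
    exact congrArg (fun t => q ⁻¹' {t}) (key H hH' ▸ rfl)
  · intro hF
    refine Subset.antisymm (fun G hG => ?_) (singleton_subset_iff.2 rfl)
    exact Subtype.ext (Cl.ext ((hF G hG).trans (hF F rfl).symm))

theorem singletonFibres_subset_VStar : singletonFibres (qStar q) ⊆ VStar q := subset_closure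

theorem isCompact_VStar_inter_meeting {C : Set Y} (hC : IsCompact C) :
    IsCompact (VStar q ∩ meeting q C) :=
  (isCompact_meeting hC).inter_left isClosed_closure

theorem mem_image_of_mem_rigidPoints [TopologicalSpace X] [T2Space X] (hq : IsQuotientMap q)
    {C : Set Y} {x : X} (hx : x ∈ rigidPoints q) (hxC : x ∈ q '' C) :
    x ∈ qStar q '' (VStar q ∩ meeting q C) := by
  obtain ⟨F, hF, hFx⟩ := exists_fibre hq x
  refine ⟨F, ⟨singletonFibres_subset_VStar ((mem_singletonFibres_iff hq).2 (hFx ▸ hx)), ?_⟩, hFx⟩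
  obtain ⟨y, hy, hyx⟩ := hxC
  exact ⟨y, hF ▸ hyx, hy⟩

/-- `q_*|V` is irreducible as soon as it is surjective: a closed subset of `V` that is mapped
onto `X` contains all singleton fibres. -/
theorem isIrreducibleMap_of_surjective
    (h : Function.Surjective ((VStar q).domRestrict (qStar q))) :
    IsIrreducibleMap ((VStar q).domRestrict (qStar q)) := by
  refine ⟨h, fun C hC hCX => ?_⟩
  obtain ⟨C', hC', rfl⟩ := isClosed_induced_iff.1 hC
  have hsub : singletonFibres (qStar q) ⊆ C' := by
    intro F hF
    obtain ⟨G, hG, hGF⟩ : qStar q F ∈ (VStar q).domRestrict (qStar q) '' (Subtype.val ⁻¹' C') :=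
      hCX ▸ mem_univ _
    have hmem : G.val ∈ qStar q ⁻¹' {qStar q F} := hGF
    rw [show qStar q ⁻¹' {qStar q F} = {F} from hF] at hmem
    exact (show G.val = F from hmem) ▸ hG
  exact eq_univ_of_forall fun G => closure_minimal hsub hC' G.property

/-- Points under members of `V` that meet `C` are limits of rigid points below any open
neighbourhood of `C`. -/
theorem image_VStar_inter_meeting_subset [TopologicalSpace X] [T2Space X] (hq : IsQuotientMap q)
    {C U : Set Y} (hU : IsOpen U) (hCU : C ⊆ U) :
    qStar q '' (VStar q ∩ meeting q C) ⊆ closure (rigidPoints q ∩ q '' U) := by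
  rintro _ ⟨F, ⟨hFV, y, hyF, hyC⟩, rfl⟩
  rw [mem_closure_iff]
  intro O hO hFO
  have hyO : q y ∈ O := by rwa [qStar_eq_of_mem hq.continuous hyF]
  obtain ⟨G, ⟨z, hzG, hzU, hzO⟩, hG⟩ := mem_closure_iff.1 hFV _
    (isOpen_meeting (hU.inter (hO.preimage hq.continuous))) ⟨y, hyF, hCU hyC, hyO⟩
  refine ⟨q z, hzO, ?_, z, hzU, rfl⟩
  rw [qStar_eq_of_mem hq.continuous hzG]
  exact (mem_singletonFibres_iff hq).1 hG

/-- Fibres over X_m \ X_{n+1} meet `K m` and miss the interior of `K (n + 1)`. By compactness a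
limit point of that set lies under such a member of `Y_*`; over a rigid point this member is the
whole fibre, which meets `K n`. -/
theorem rigidPoints_inter_image_subset [TopologicalSpace X] [T2Space X] (hq : IsQuotientMap q)
    (K : CompactExhaustion Y) (n : ℕ) :
    rigidPoints q ∩ q '' K n ⊆ stablePoints q K (n + 1) := by
  rintro x ⟨hx, y, hy, rfl⟩ m hm
  have hcpt : IsCompact (meeting q (K m) \ meeting q (interior (K (n + 1)))) :=
    (isCompact_meeting (K.isCompact m)).diff (isOpen_meeting isOpen_interior)
  have hsub : q '' K m \ q '' K (n + 1) ⊆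
      qStar q '' (meeting q (K m) \ meeting q (interior (K (n + 1)))) := by
    rintro x' ⟨⟨w, hw, hwx⟩, hx'⟩
    obtain ⟨F, hF, hFx⟩ := exists_fibre hq x'
    refine ⟨F, ⟨⟨w, hF ▸ hwx, hw⟩, ?_⟩, hFx⟩
    rintro ⟨t, htF, ht⟩
    exact hx' ⟨t, interior_subset ht, (qStar_eq_of_mem hq.continuous htF).trans hFx⟩
  obtain ⟨F, ⟨-, hF⟩, hFx⟩ :=
    closure_minimal hsub (hcpt.image (continuous_qStar hq.continuous)).isClosed hm
  exact hF ⟨y, hx F hFx ▸ rfl, K.subset_interior_succ n hy⟩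

/-- A point of `X` is rigid if it is stable for `q '' K n` and the fibres of `q` over `q '' K n`
vary continuously there. -/
theorem mem_rigidPoints [TopologicalSpace X] [T2Space X] [RegularSpace Y] [LocallyCompactSpace Y]
    (hq : IsQuotientMap q) {K : CompactExhaustion Y} {n : ℕ} {x : X}
    (hx : x ∈ stablePoints q K n) {b : Set (Set Y)} (hb : IsTopologicalBasis b)
    (h : ∀ B ∈ b, IsCompact (closure B) → x ∈ q '' closure B →
      ∃ O : Set X, IsOpen O ∧ x ∈ O ∧ O ∩ q '' K n ⊆ q '' closure B) :
    x ∈ rigidPoints q := by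
  intro F hF
  refine Subset.antisymm (hF ▸ carrier_subset hq.continuous F) fun y hy => ?_
  by_contra hyF
  obtain ⟨C, hCy, hCF, hC⟩ := local_compact_nhds (F.val.isClosed.isOpen_compl.mem_nhds hyF)
  obtain ⟨D, hDy, hDcl, hDC⟩ := exists_mem_nhds_isClosed_subset hCy
  obtain ⟨B, hB, hyB, hBD⟩ := hb.mem_nhds_iff.1 hDy
  have hBC : closure B ⊆ C := (closure_minimal hBD hDcl).trans hDC
  have hBcpt : IsCompact (closure B) := hC.of_isClosed_subset isClosed_closure hBC
  obtain ⟨O, hO, hxO, hOB⟩ := h B hB hBcpt ⟨y, subset_closure hyB, hy⟩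
  obtain ⟨w, hw⟩ := F.property.2
  have hwx : q w = x := (qStar_eq_of_mem hq.continuous hw).trans hF
  obtain ⟨m, hm⟩ := K.exists_mem w
  -- Near `w`, stability forces `q` into `q '' K n`, hence into `q '' closure B`. But `F`, which
  -- misses `closure B`, is approximated by fibres that miss it too and pass near `w`.
  have hopen : IsOpen (interior (K (m + 1)) ∩
      q ⁻¹' (O ∩ (closure (q '' K (m + 1) \ q '' K n))ᶜ)) :=
    isOpen_interior.inter ((hO.inter isClosed_closure.isOpen_compl).preimage hq.continuous)
  obtain ⟨z, ⟨hzK, hzO, hz⟩, hzB⟩ := exists_fibre_inter F hopen hBcpt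
    ⟨w, hw, K.subset_interior_succ m hm, by rwa [hwx], by rw [hwx]; exact hx _⟩
    (eq_empty_iff_forall_notMem.2 fun t ht => hCF (hBC ht.2) ht.1)
  have hzn : q z ∈ q '' K n := by
    by_contra hzn
    exact hz (subset_closure ⟨⟨z, interior_subset hzK, rfl⟩, hzn⟩)
  obtain ⟨t, ht, htz⟩ := hOB ⟨hzO, hzn⟩
  exact hzB t ht htz

end YStar

/-! ### Generic stable points are rigid -/

section Baire

variable {X : Type u} {Y : Type v} [TopologicalSpace X] [T2Space X] [TopologicalSpace Y]
  [RegularSpace Y] [LocallyCompactSpace Y] [SecondCountableTopology Y] {q : Y → X}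

/-- If the `p`-stable points are dense in `q '' K n`, then the `n`-stable points are limits of rigid
points of `q '' K p`. -/
theorem stablePoints_subset_closure (hq : IsQuotientMap q) {K : CompactExhaustion Y} {n p : ℕ}
    (h : q '' K n ⊆ closure (stablePoints q K p)) :
    stablePoints q K n ⊆ closure (rigidPoints q ∩ q '' K p) := by
  intro x hx
  rw [mem_closure_iff]
  intro O hO hxO
  have hDp : stablePoints q K p ⊆ q '' K p := stablePoints_subset_image hq p
  have hXp : IsCompact (q '' K p) := (K.isCompact p).image hq.continuous
  have hnp : q '' K n ⊆ q '' K p := h.trans (closure_minimal hDp hXp.isClosed)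
  have : CompactSpace (q '' K p) := isCompact_iff_compactSpace.1 hXp
  let ι : q '' K p → X := Subtype.val
  have hι : Continuous ι := continuous_subtype_val
  let b := {B ∈ countableBasis Y | IsCompact (closure B)}
  have hbc : Countable b := ((countable_countableBasis Y).mono (sep_subset _ _)).to_subtype
  let A : b → Set (q '' K p) := fun B => ι ⁻¹' (q '' closure B.val)
  have hAcl : ∀ B, IsClosed (A B) := fun B =>
    (B.property.2.image hq.continuous).isClosed.preimage hι
  -- The second piece makes `T m` dense; on the closure of the stable points, lying in all `T m`
  -- means being `p`-stable.
  let T : ℕ → Set (q '' K p) := fun m =>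
    (ι ⁻¹' closure (q '' K m \ q '' K p))ᶜ ∪ (closure (ι ⁻¹' stablePoints q K p))ᶜ
  have hTo : ∀ m, IsOpen (T m) := fun m =>
    (isClosed_closure.preimage hι).isOpen_compl.union isClosed_closure.isOpen_compl
  have hTd : ∀ m, Dense (T m) := by
    intro m z
    by_cases hz : z ∈ closure (ι ⁻¹' stablePoints q K p)
    · exact closure_mono (t := T m) (fun w hw => Or.inl ((hw : w.val ∈ stablePoints q K p) m)) hz
    · exact subset_closure (Or.inr hz)
  -- Off the frontier of the closed set `A B`, membership in it persists nearby: this is the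
  -- continuity of fibres required by `mem_rigidPoints`.
  have hdense : Dense ((⋂ m, T m) ∩ ⋂ B, (frontier (A B))ᶜ) := by
    refine (dense_iInter_of_isOpen hTo hTd).inter_of_Gδ (IsGδ.iInter_of_isOpen hTo)
      (IsGδ.iInter_of_isOpen fun B => isClosed_frontier.isOpen_compl)
      (dense_iInter_of_isOpen (fun B => isClosed_frontier.isOpen_compl) fun B => ?_)
    rw [← interior_eq_empty_iff_dense_compl]
    exact interior_frontier (hAcl B)
  -- Since `x` is `n`-stable, this is a neighbourhood of it in `q '' K p`; it lies in `q '' K n`,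
  -- where `p`-stable points are dense.
  have hU : IsOpen (ι ⁻¹' (O ∩ (closure (q '' K p \ q '' K n))ᶜ)) :=
    (hO.inter isClosed_closure.isOpen_compl).preimage hι
  obtain ⟨s, ⟨hsO, hsn⟩, hsT, hsA⟩ := hdense.inter_open_nonempty _ hU
    ⟨⟨x, hnp (stablePoints_subset_image hq n hx)⟩, hxO, hx p⟩
  have hsn' : s.val ∈ q '' K n := by
    by_contra hcon
    exact hsn (subset_closure ⟨s.property, hcon⟩)
  have hscl : s ∈ closure (ι ⁻¹' stablePoints q K p) := by
    rw [closure_subtype, Subtype.image_preimage_coe, inter_eq_right.2 hDp]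
    exact h hsn'
  have hsp : s.val ∈ stablePoints q K p := fun m =>
    (mem_iInter.1 hsT m).resolve_right fun hcon => hcon hscl
  refine ⟨s.val, hsO, mem_rigidPoints hq hsp (isBasis_countableBasis Y) ?_, s.property⟩
  intro B hB hBc hsB
  have hsB' : s ∈ A ⟨B, hB, hBc⟩ := hsB
  have hsi : s ∈ interior (A ⟨B, hB, hBc⟩) := by
    by_contra hcon
    exact mem_iInter.1 hsA ⟨B, hB, hBc⟩ ⟨subset_closure hsB', hcon⟩
  obtain ⟨W, hWA, hW, hsW⟩ := mem_interior.1 hsi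
  obtain ⟨O', hO', rfl⟩ := isOpen_induced_iff.1 hW
  exact ⟨O', hO', hsW, fun z hz => hWA (show (⟨z, hz.2⟩ : q '' K p) ∈ _ from hz.1)⟩

end Baire

/-! ### The two implications -/

section Main

variable {X : Type u} {Y : Type v} [TopologicalSpace X] [T2Space X] [MetricSpace Y] {q : Y → X}

theorem isQuotientMap_domRestrict_VStar [LocallyCompactSpace Y] [SecondCountableTopology Y]
    (hq : IsQuotientMap q) (K : CompactExhaustion Y) {E : Set X} (hd : SeqDense E)
    (hE : ∀ x ∈ E, IsCompactType x)
    (hA : PropertyA E) (hB : PropertyB E) :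
    IsQuotientMap ((VStar q).domRestrict (qStar q)) := by
  have hcore : ∀ p, IsCompact (qStar q '' (VStar q ∩ meeting q (K p))) := fun p =>
    (isCompact_VStar_inter_meeting (K.isCompact p)).image (continuous_qStar hq.continuous)
  have hdense : ∀ n, ∃ p, q '' K n ⊆ closure (stablePoints q K p) := by
    intro n
    obtain ⟨m, hm⟩ := hB.exists_subset_closure hq K hd n
    obtain ⟨p, hp⟩ := hA.exists_subset_stablePoints hq K hE m
    exact ⟨p, hm.trans (closure_mono hp)⟩
  have hstable : ∀ n, ∃ p, stablePoints q K n ⊆ qStar q '' (VStar q ∩ meeting q (K p)) := by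
    intro n
    obtain ⟨p, hp⟩ := hdense n
    refine ⟨p, (stablePoints_subset_closure hq hp).trans (closure_minimal ?_ (hcore p).isClosed)⟩
    exact fun x hx => mem_image_of_mem_rigidPoints hq hx.1 hx.2
  refine isQuotientMap_of_image_subset hq K
    ((continuous_qStar hq.continuous).comp continuous_subtype_val) fun n => ?_
  obtain ⟨m, hm⟩ := hdense n
  obtain ⟨p, hp⟩ := hstable m
  refine ⟨Subtype.val ⁻¹' meeting q (K p), ?_, ?_⟩
  · rw [IsInducing.subtypeVal.isCompact_iff, Subtype.image_preimage_coe]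
    exact isCompact_VStar_inter_meeting (K.isCompact p)
  · refine (hm.trans (closure_minimal hp (hcore p).isClosed)).trans ?_
    rintro _ ⟨F, ⟨hFV, hF⟩, rfl⟩
    exact ⟨⟨F, hFV⟩, hF, rfl⟩

/-- The members of `V` meeting `K m` exhaust `V` as m grows, so one of these sets covers the compact
set `q '' K n`; such members are approximated by singleton fibres meeting the interior of `K (m +
1)`. -/
theorem exists_image_subset_closure_rigidPoints (hq : IsQuotientMap q) (K : CompactExhaustion Y)
    (hr : IsQuotientMap ((VStar q).domRestrict (qStar q))) (n : ℕ) :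
    ∃ m, q '' K n ⊆ closure (rigidPoints q ∩ q '' K m) := by
  let W : ℕ → Set (VStar q) := fun m => Subtype.val ⁻¹' meeting q (K m)
  have hW : ∀ m, W m ⊆ interior (W (m + 1)) := by
    intro m F hF
    refine mem_interior.2 ⟨Subtype.val ⁻¹' meeting q (interior (K (m + 1))),
      preimage_mono (meeting_mono interior_subset),
      (isOpen_meeting isOpen_interior).preimage continuous_subtype_val, ?_⟩
    exact meeting_mono (K.subset_interior_succ m) hF
  have hU : ∀ F, ∃ m, F ∈ W m := by
    intro F
    obtain ⟨y, hy⟩ := F.val.property.2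
    obtain ⟨m, hm⟩ := K.exists_mem y
    exact ⟨m, y, hy, hm⟩
  obtain ⟨m, hm⟩ := exists_subset_image_of_isCompact hr hW hU ((K.isCompact n).image hq.continuous)
  refine ⟨m + 1, fun x hx => ?_⟩
  obtain ⟨F, hF, rfl⟩ := hm hx
  exact closure_mono (inter_subset_inter_right _ (image_mono interior_subset))
    (image_VStar_inter_meeting_subset hq isOpen_interior (K.subset_interior_succ m)
      ⟨F.val, ⟨F.property, hF⟩, rfl⟩)

theorem seqDense_of_image_subset_closure (hq : IsQuotientMap q) (K : CompactExhaustion Y)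
    {E : Set X} (h : ∀ n, ∃ m, q '' K n ⊆ closure (E ∩ q '' K m)) : SeqDense E := by
  refine eq_univ_of_forall fun x => ?_
  obtain ⟨n, hn⟩ := exists_mem_image hq K x
  obtain ⟨m, hm⟩ := h n
  obtain ⟨u, hu, hlim⟩ := exists_seq_of_mem_closure hq.continuous (K.isCompact m)
    inter_subset_right (hm hn)
  exact ⟨u, fun j => (hu j).1, hlim⟩

theorem isCompactType_of_mem_stablePoints (hq : IsQuotientMap q) {K : CompactExhaustion Y}
    {n : ℕ} {x : X} (hx : x ∈ stablePoints q K n) : IsCompactType x :=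
  ⟨q '' K n, (K.isCompact n).image hq.continuous,
    fun _ hu => eventually_mem_of_mem_stablePoints hq hx hu⟩

theorem propertyA_of_subset_stablePoints (hq : IsQuotientMap q) (K : CompactExhaustion Y)
    {E : Set X} (h : ∀ n, ∃ m, E ∩ q '' K n ⊆ stablePoints q K m) : PropertyA E := by
  intro x x₀ _ hxE hx
  obtain ⟨n, hn⟩ := exists_forall_mem_of_tendsto hq K hx
  obtain ⟨m, hm⟩ := h n
  refine ⟨id, strictMono_id, fun z hz => ?_⟩
  choose k hk using fun i => eventually_atTop.1
    (eventually_mem_of_mem_stablePoints hq (hm ⟨hxE i, hn i⟩) (hz i))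
  have hcpt : IsCompact (q '' K m) := (K.isCompact m).image hq.continuous
  refine ⟨k, hcpt.of_isClosed_subset isClosed_closure (closure_minimal ?_ hcpt.isClosed)⟩
  rintro _ ⟨i, j, hj, rfl⟩
  exact hk i j hj

/-- The points and their approximants are lifted to `Y`, where the metric controls all diagonals at
once. -/
theorem propertyB_of_image_subset_closure (hq : IsQuotientMap q) (K : CompactExhaustion Y)
    {E : Set X} (h : ∀ n, ∃ m, q '' K n ⊆ closure (E ∩ q '' K m)) : PropertyB E := by
  intro x x₀ _ hx
  obtain ⟨n, hn⟩ := exists_forall_mem_of_tendsto hq K hx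
  obtain ⟨m, hm⟩ := h n
  choose w hwK hwx u hu hlim using fun i =>
    exists_lift_of_mem_closure hq.continuous (K.isCompact m) inter_subset_right (hm (hn i))
  obtain ⟨w₀, -, φ, hφ, hw₀⟩ := (K.isCompact m).tendsto_subseq hwK
  have hx₀ : q w₀ = x₀ := by
    refine tendsto_nhds_unique ((hq.continuous.tendsto w₀).comp hw₀) ?_
    convert hx.comp hφ.tendsto_atTop using 1
    exact funext fun i => hwx (φ i)
  -- Dropping the first `k i` terms keeps the i-th lifted sequence within 1/(i+1) of its limit, so
  -- every diagonal tends to `w₀`.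
  choose k hk using fun i => eventually_atTop.1
    ((hlim (φ i)) (Metric.ball_mem_nhds _ (Nat.one_div_pos_of_nat (α := ℝ) (n := i))))
  refine ⟨φ, hφ, fun i j => q (u (φ i) (j + k i)), fun i j => (hu _ _).1, fun i => ?_,
    fun d => ?_⟩
  · rw [← hwx (φ i)]
    exact (hq.continuous.tendsto _).comp ((tendsto_add_atTop_iff_nat (k i)).2 (hlim (φ i)))
  · rw [← hx₀]
    refine (hq.continuous.tendsto w₀).comp (hw₀.congr_dist ?_)
    refine squeeze_zero (fun _ => dist_nonneg) (fun i => ?_)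
      (tendsto_one_div_add_atTop_nhds_zero_nat (𝕜 := ℝ))
    rw [dist_comm]
    exact (hk i _ (Nat.le_add_left _ _)).le

end Main

end FellQuotient

open FellQuotient

theorem theorem5p4 {X : Type*} {Y : Type*} [TopologicalSpace X] [T2Space X]
    [MetricSpace Y] [LocallyCompactSpace Y] [TopologicalSpace.SeparableSpace Y]
    (q : Y → X) (hq : Topology.IsQuotientMap q) :
    (∃ E : Set X, FellQuotient.SeqDense E ∧ (∀ x ∈ E, FellQuotient.IsCompactType x) ∧
        FellQuotient.PropertyA E ∧ FellQuotient.PropertyB E) ↔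
      (Topology.IsQuotientMap ((FellQuotient.VStar q).domRestrict (FellQuotient.qStar q)) ∧
        FellQuotient.IsIrreducibleMap
          ((FellQuotient.VStar q).domRestrict (FellQuotient.qStar q))) := by
  have : SecondCountableTopology Y := UniformSpace.secondCountable_of_separable Y
  have K : CompactExhaustion Y := default
  constructor
  · rintro ⟨E, hd, hE, hA, hB⟩
    have hr := isQuotientMap_domRestrict_VStar hq K hd hE hA hB
    exact ⟨hr, isIrreducibleMap_of_surjective hr.surjective⟩
  · rintro ⟨hr, -⟩
    have hcl := exists_image_subset_closure_rigidPoints hq K hr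
    have hst : ∀ n, ∃ m, rigidPoints q ∩ q '' K n ⊆ stablePoints q K m := fun n =>
      ⟨n + 1, rigidPoints_inter_image_subset hq K n⟩
    refine ⟨rigidPoints q, seqDense_of_image_subset_closure hq K hcl, fun x hx => ?_,
      propertyA_of_subset_stablePoints hq K hst, propertyB_of_image_subset_closure hq K hcl⟩
    obtain ⟨n, hn⟩ := exists_mem_image hq K x
    obtain ⟨m, hm⟩ := hst n
    exact isCompactType_of_mem_stablePoints hq (hm ⟨hx, hn⟩)
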